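/- Let $L$ be a finite nonempty lattice. An element of $L$ is join-irreducible if it is not the minimum of $L$ and is not the join of two strictly smaller elements; meet-irreducible elements are defined dually. Let $\mathcal J$ and $\mathcal M$ be the sets of join-irreducible and meet-irreducible elements of $L$. Suppose that $L$ is extremal, i.e. $|\mathcal J|=|\mathcal M|=n$, where $n$ is the length of $L$ (the maximal $r$ for which there is a chain $x_0<x_1<\dots<x_r$ in $L$), and semidistributive, i.e. for all $x,y,z\in L$, $$x\vee y=x\vee z\implies x\vee(y\wedge z)=x\vee y,\qquad x\wedge y=x\wedge z\implies x\wedge(y\vee z)=x\wedge y .$$ Let $x_0<x_1<\dots<x_n$ be any chain of maximal length in $L$, and let $j_1,\dots,j_n$ and $m_1,\dots,m_n$ be the indexings of $\mathcal J$ and $\mathcal M$ that it induces, i.e. the unique ones such that $x_i=j_1\vee\dots\vee j_i=m_{i+1}\wedge\dots\wedge m_n$ for $0\le i\le n$. The Galois graph $G(L)$ is the directed graph on $\{1,\dots,n\}$ with an edge $i\to k$ whenever $i\ne k$ and $j_i\not\le m_k$. A set $A\subseteq\mathcal J$ is a canonical join representation of $x\in L$ if $\bigvee A=x$, $\bigvee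 A'<x$ for every $A'\subsetneq A$, and for every $B\subseteq\mathcal J$ with $\bigvee B=x$ and every $a\in A$ there is $b\in B$ with $a\le b$. The canonical join complex of $L$ is the simplicial complex with vertex set $\mathcal J$ whose faces are the canonical join representations of elements of $L$, and the canonical join graph $C(L)$ is its $1$-skeleton. Then, identifying the vertex $i$ of $G(L)$ with $j_i$, the complement of the undirected graph underlying $G(L)$ is $C(L)$; that is, for all $i\neq k$, the set $\{j_i,j_k\}$ is a canonical join representation of some element of $L$ if and only if $G(L)$ contains neither of the edges $i\to k$ and $k\to i$. -/

import Mathlib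

/-! ### Semidistributive and extremal lattices -/

/-- A lattice is semidistributive if it is both join- and meet-semidistributive. -/
def IsSemidistributive (L : Type*) [Lattice L] : Prop :=
  (∀ x y z : L, x ⊔ y = x ⊔ z → x ⊔ (y ⊓ z) = x ⊔ y) ∧
  (∀ x y z : L, x ⊓ y = x ⊓ z → x ⊓ (y ⊔ z) = x ⊓ y)

/-- A finite lattice of length `n` is extremal if it has exactly `n` join-irreducible and exactly
`n` meet-irreducible elements.  `Order.krullDim L` is the supremum of the lengths of the chains
`x₀ < x₁ < ⋯ < x_r` of `L`, that is, the length of `L`. -/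
def IsExtremal (L : Type*) [Lattice L] : Prop :=
  Order.krullDim L = (Nat.card {a : L // SupIrred a} : WithBot ℕ∞) ∧
  Order.krullDim L = (Nat.card {a : L // InfIrred a} : WithBot ℕ∞)

/-- A chain of maximal length: no chain is longer. -/
def IsMaxLengthChain {L : Type*} [Preorder L] (c : LTSeries L) : Prop :=
  ∀ d : LTSeries L, d.length ≤ c.length

/-! ### The indexing of the irreducibles induced by a chain of maximal length -/

theorem exists_supIrred_le_not_le {L : Type*} [Lattice L] [Finite L] {x y : L} (h : ¬ y ≤ x) :
    ∃ a, SupIrred a ∧ a ≤ y ∧ ¬ a ≤ x := by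
  obtain ⟨a, -, ha⟩ := (Set.toFinite {a : L | a ≤ y ∧ ¬ a ≤ x}).exists_le_minimal ⟨le_rfl, h⟩
  refine ⟨a, ⟨fun hmin => ha.prop.2 ?_, fun b d hbd => ?_⟩, ha.prop.1, ha.prop.2⟩
  · exact (hmin inf_le_left).trans inf_le_right
  · by_contra! hne
    have key : ∀ e, e ≤ a → e ≠ a → e ≤ x := fun e he hne' => by
      by_contra hx
      exact hne' (le_antisymm he (ha.le_of_le ⟨he.trans ha.prop.1, hx⟩ he))
    apply ha.prop.2
    rw [← hbd]
    exact sup_le (key b (hbd ▸ le_sup_left) hne.1) (key d (hbd ▸ le_sup_right) hne.2)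

theorem exists_infIrred_le_not_le {L : Type*} [Lattice L] [Finite L] {x y : L} (h : ¬ y ≤ x) :
    ∃ a, InfIrred a ∧ x ≤ a ∧ ¬ y ≤ a := by
  obtain ⟨a, ha, h1, h2⟩ := exists_supIrred_le_not_le (L := Lᵒᵈ)
    (x := OrderDual.toDual y) (y := OrderDual.toDual x) (fun h' => h h')
  exact ⟨OrderDual.ofDual a, ha.ofDual, h1, h2⟩

theorem IsMaxLengthChain.krullDim_eq {L : Type*} [Preorder L] {c : LTSeries L}
    (hc : IsMaxLengthChain c) : Order.krullDim L = (c.length : WithBot ℕ∞) :=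
  le_antisymm (iSup_le fun d => by exact_mod_cast hc d) (Order.LTSeries.length_le_krullDim c)

/-- A maximal-length chain `x₀ ⋖ x₁ ⋖ ⋯ ⋖ x_n` of an extremal lattice determines a unique
indexing `j₁, …, j_n` of the join-irreducibles such that `x_i = j₁ ∨ ⋯ ∨ j_i` for `0 ≤ i ≤ n`.
The indices are shifted by one: `j_{k+1}` is `j k` with `k : Fin n`. -/
theorem existsUnique_joinIndexing {L : Type*} [Lattice L] [Finite L] (hL : IsExtremal L)
    (c : LTSeries L) (hc : IsMaxLengthChain c) :
    ∃! j : Fin c.length ≃ {a : L // SupIrred a}, ∀ i : Fin (c.length + 1),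
      IsLUB {a : L | ∃ k : Fin c.length, k.castSucc < i ∧ (j k : L) = a} (c i) := by
  have hcard : Nat.card {a : L // SupIrred a} = c.length := by
    have := hL.1.symm.trans hc.krullDim_eq
    exact_mod_cast this
  have hm : Monotone c := c.monotone
  have hex : ∀ k : Fin c.length, ∃ a : {a : L // SupIrred a},
      (a : L) ≤ c k.succ ∧ ¬ (a : L) ≤ c k.castSucc := fun k => by
    obtain ⟨a, h1, h2, h3⟩ :=
      exists_supIrred_le_not_le (c.strictMono (Fin.castSucc_lt_succ (i := k))).not_ge
    exact ⟨⟨a, h1⟩, h2, h3⟩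
  choose f hf1 hf2 using hex
  have hlt : ∀ k l : Fin c.length, (f l : L) ≤ c k.succ → ¬ (f l : L) ≤ c k.castSucc → l = k := by
    intro k l h1 h2
    rcases lt_trichotomy l k with h | h | h
    · exact absurd ((hf1 l).trans (hm (Fin.succ_le_castSucc_iff.2 h))) h2
    · exact h
    · exact absurd (h1.trans (hm (Fin.succ_le_castSucc_iff.2 h))) (hf2 l)
  have hinj : Function.Injective f := fun k l hkl =>
    hlt l k (hkl ▸ hf1 l) (hkl ▸ hf2 l)
  have hbij : Function.Bijective f :=
    (Nat.bijective_iff_injective_and_card f).2 ⟨hinj, by simp [hcard]⟩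
  refine ⟨Equiv.ofBijective f hbij, fun i => ⟨?_, fun u hu => ?_⟩, fun j hj => ?_⟩
  · rintro _ ⟨k, hk, rfl⟩
    exact (hf1 k).trans (hm (Fin.castSucc_lt_iff_succ_le.1 hk))
  · by_contra hne
    obtain ⟨a, h1, h2, h3⟩ := exists_supIrred_le_not_le hne
    obtain ⟨k, hk⟩ := hbij.2 ⟨a, h1⟩
    have hk' : (f k : L) = a := by rw [hk]
    by_cases hki : k.castSucc < i
    · exact h3 (hu ⟨k, hki, hk'⟩)
    · exact hf2 k (hk' ▸ h2.trans (hm (not_lt.1 hki)))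
  · ext k
    obtain ⟨l, hl⟩ := hbij.2 (j k)
    have h1 : (j k : L) ≤ c k.succ := (hj k.succ).1 ⟨k, Fin.castSucc_lt_succ, rfl⟩
    have h2 : ¬ (j k : L) ≤ c k.castSucc := fun h => by
      refine (c.strictMono (Fin.castSucc_lt_succ (i := k))).not_ge ((hj k.succ).2 ?_)
      rintro _ ⟨l, hl, rfl⟩
      rcases (Fin.castSucc_lt_succ_iff.1 hl).lt_or_eq with h' | h'
      · exact (hj k.castSucc).1 ⟨l, Fin.castSucc_lt_castSucc_iff.2 h', rfl⟩
      · rw [h']; exact h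
    have hlk : l = k := hlt k l (hl ▸ h1) (hl ▸ h2)
    simp [← hl, hlk]

/-- A maximal-length chain `x₀ ⋖ x₁ ⋖ ⋯ ⋖ x_n` of an extremal lattice determines a unique
indexing `m₁, …, m_n` of the meet-irreducibles such that `x_i = m_{i+1} ∧ ⋯ ∧ m_n` for
`0 ≤ i ≤ n`.  The indices are shifted by one: `m_{k+1}` is `m k` with `k : Fin n`. -/
theorem existsUnique_meetIndexing {L : Type*} [Lattice L] [Finite L] (hL : IsExtremal L)
    (c : LTSeries L) (hc : IsMaxLengthChain c) :
    ∃! m : Fin c.length ≃ {a : L // InfIrred a}, ∀ i : Fin (c.length + 1),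
      IsGLB {a : L | ∃ k : Fin c.length, i ≤ k.castSucc ∧ (m k : L) = a} (c i) := by
  have hcard : Nat.card {a : L // InfIrred a} = c.length := by
    have := hL.2.symm.trans hc.krullDim_eq
    exact_mod_cast this
  have hm : Monotone c := c.monotone
  have hex : ∀ k : Fin c.length, ∃ a : {a : L // InfIrred a},
      c k.castSucc ≤ (a : L) ∧ ¬ c k.succ ≤ (a : L) := fun k => by
    obtain ⟨a, h1, h2, h3⟩ :=
      exists_infIrred_le_not_le (c.strictMono (Fin.castSucc_lt_succ (i := k))).not_ge
    exact ⟨⟨a, h1⟩, h2, h3⟩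
  choose f hf1 hf2 using hex
  have hlt : ∀ k l : Fin c.length, c k.castSucc ≤ (f l : L) → ¬ c k.succ ≤ (f l : L) → l = k := by
    intro k l h1 h2
    rcases lt_trichotomy l k with h | h | h
    · exact absurd ((hm (Fin.succ_le_castSucc_iff.2 h)).trans h1) (hf2 l)
    · exact h
    · exact absurd ((hm (Fin.succ_le_castSucc_iff.2 h)).trans (hf1 l)) h2
  have hinj : Function.Injective f := fun k l hkl =>
    hlt l k (hkl ▸ hf1 l) (hkl ▸ hf2 l)
  have hbij : Function.Bijective f :=
    (Nat.bijective_iff_injective_and_card f).2 ⟨hinj, by simp [hcard]⟩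
  refine ⟨Equiv.ofBijective f hbij, fun i => ⟨?_, fun u hu => ?_⟩, fun j hj => ?_⟩
  · rintro _ ⟨k, hk, rfl⟩
    exact (hm hk).trans (hf1 k)
  · by_contra hne
    obtain ⟨a, h1, h2, h3⟩ := exists_infIrred_le_not_le hne
    obtain ⟨k, hk⟩ := hbij.2 ⟨a, h1⟩
    have hk' : (f k : L) = a := by rw [hk]
    by_cases hki : i ≤ k.castSucc
    · exact h3 (hu ⟨k, hki, hk'⟩)
    · exact hf2 k (hk' ▸ (hm (Fin.castSucc_lt_iff_succ_le.1 (not_le.1 hki))).trans h2)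
  · ext k
    obtain ⟨l, hl⟩ := hbij.2 (j k)
    have h1 : c k.castSucc ≤ (j k : L) := (hj k.castSucc).1 ⟨k, le_rfl, rfl⟩
    have h2 : ¬ c k.succ ≤ (j k : L) := fun h => by
      refine (c.strictMono (Fin.castSucc_lt_succ (i := k))).not_ge ((hj k.castSucc).2 ?_)
      rintro _ ⟨l, hl, rfl⟩
      rcases (Fin.castSucc_le_castSucc_iff.1 hl).eq_or_lt with h' | h'
      · rw [← h']; exact h
      · exact (hj k.succ).1 ⟨l, Fin.succ_le_castSucc_iff.2 h', rfl⟩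
    have hlk : l = k := hlt k l (hl ▸ h1) (hl ▸ h2)
    simp [← hl, hlk]

/-- The indexing `j` of the join-irreducibles induced by a maximal-length chain. -/
noncomputable def joinIndexing {L : Type*} [Lattice L] [Finite L] (hL : IsExtremal L)
    (c : LTSeries L) (hc : IsMaxLengthChain c) : Fin c.length ≃ {a : L // SupIrred a} :=
  (existsUnique_joinIndexing hL c hc).choose

/-- The indexing `m` of the meet-irreducibles induced by a maximal-length chain. -/
noncomputable def meetIndexing {L : Type*} [Lattice L] [Finite L] (hL : IsExtremal L)
    (c : LTSeries L) (hc : IsMaxLengthChain c) : Fin c.length ≃ {a : L // InfIrred a} :=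
  (existsUnique_meetIndexing hL c hc).choose

/-- The Galois graph of an extremal lattice, with respect to a chain of maximal length `n`: the
directed graph on `n` vertices with an edge `i → k` when `i ≠ k` and `j_i ≰ m_k`. -/
noncomputable def galoisGraph {L : Type*} [Lattice L] [Finite L] (hL : IsExtremal L)
    (c : LTSeries L) (hc : IsMaxLengthChain c) : Digraph (Fin c.length) where
  Adj i k := ¬ ((joinIndexing hL c hc i : L) ≤ (meetIndexing hL c hc k : L)) ∧ i ≠ k

/-! ### The canonical join complex -/

/-- `A` is a canonical join representation of `x`: it is a set of join-irreducibles, it is an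
irredundant join representation of `x`, and it refines every join representation of `x` by
join-irreducibles. -/
def IsCanonicalJoinRep {L : Type*} [Lattice L] (A : Set L) (x : L) : Prop :=
  (∀ a ∈ A, SupIrred a) ∧ IsLUB A x ∧ (∀ A' : Set L, A' ⊂ A → ∀ y, IsLUB A' y → y < x) ∧
  ∀ B : Set L, (∀ b ∈ B, SupIrred b) → IsLUB B x → ∀ a ∈ A, ∃ b ∈ B, a ≤ b

theorem isCanonicalJoinRep_singleton {L : Type*} [Lattice L] [Finite L] {a : L}
    (ha : SupIrred a) : IsCanonicalJoinRep {a} a := by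
  refine ⟨by simpa using ha, isLUB_singleton, fun A' hA' y hy => ?_, fun B _ hB b hb => ?_⟩
  · rw [Set.ssubset_singleton_iff.1 hA', isLUB_empty_iff] at hy
    exact lt_of_le_of_ne (hy a) fun h => ha.1 fun b _ => h ▸ hy b
  · rw [Set.mem_singleton_iff.1 hb]
    have := Fintype.ofFinite L
    have : Nonempty L := ⟨a⟩
    let _ := Fintype.toOrderBot L
    obtain ⟨s, rfl⟩ := B.toFinite.exists_finset_coe
    have hs : s.sup id = a := by
      have h := Finset.isLUB_sup_id (s := s)
      exact h.unique hB
    obtain ⟨i, hi, h⟩ := ha.finset_sup_eq hs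
    exact ⟨i, hi, h.ge⟩

theorem IsCanonicalJoinRep.subset {L : Type*} [Lattice L] [Finite L] {A A' : Set L} {x : L}
    (h : IsCanonicalJoinRep A x) (hA : A' ⊆ A) : ∃ y, IsCanonicalJoinRep A' y := by
  have hlub : ∃ y, IsLUB A' y := by
    have := Fintype.ofFinite L
    have : Nonempty L := ⟨x⟩
    let _ := Fintype.toOrderBot L
    obtain ⟨s, rfl⟩ := A'.toFinite.exists_finset_coe
    exact ⟨_, Finset.isLUB_sup_id⟩
  obtain ⟨y, hy⟩ := hlub
  obtain ⟨h1, h2, h3, h4⟩ := h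
  have key : ∀ B : Set L, IsLUB B y → IsLUB (B ∪ (A \ A')) x := by
    intro B hB
    have : upperBounds (B ∪ (A \ A')) = upperBounds A := by
      rw [upperBounds_union, hB.upperBounds_eq, ← hy.upperBounds_eq, ← upperBounds_union,
        Set.union_sdiff_cancel hA]
    rw [IsLUB, this]
    exact h2
  refine ⟨y, fun a ha => h1 a (hA ha), hy, fun A'' hA'' z hz => ?_, fun B hBJ hB a ha => ?_⟩
  · refine lt_of_le_of_ne (hz.mono hy hA''.1) ?_
    rintro rfl
    obtain ⟨b, hb, hb'⟩ := Set.exists_of_ssubset hA''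
    refine lt_irrefl x (h3 (A'' ∪ (A \ A')) ?_ x (key _ hz))
    refine (Set.ssubset_iff_of_subset
      (Set.union_subset (hA''.1.trans hA) Set.sdiff_subset)).2 ⟨b, hA hb, ?_⟩
    rintro (h | h)
    · exact hb' h
    · exact h.2 hb
  · obtain ⟨b, hb | hb, hab⟩ := h4 (B ∪ (A \ A'))
      (by rintro b (hb | hb); exacts [hBJ b hb, h1 b hb.1]) (key B hB) a (hA ha)
    · exact ⟨b, hb, hab⟩
    · exfalso
      have hne : b ≠ a := fun h => hb.2 (h ▸ ha)
      refine lt_irrefl x (h3 (A \ {a}) ?_ x ?_)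
      · exact (Set.ssubset_iff_of_subset Set.sdiff_subset).2 ⟨a, hA ha, by simp⟩
      · refine ⟨fun e he => h2.1 he.1, fun u hu => h2.2 fun e he => ?_⟩
        by_cases hea : e = a
        · rw [hea]; exact hab.trans (hu ⟨hb.1, hne⟩)
        · exact hu ⟨he, hea⟩

/-- The canonical join complex: its vertices are the join-irreducible elements, and its faces are
the (nonempty) canonical join representations. -/
def canonicalJoinComplex (L : Type*) [Lattice L] [Finite L] :
    AbstractSimplicialComplex {a : L // SupIrred a} where
  faces := {s | s.Nonempty ∧ ∃ x : L, IsCanonicalJoinRep (Subtype.val '' (s : Set {a : L // SupIrred a})) x}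
  isRelLowerSet_faces := by
    rintro s ⟨hs, x, hx⟩
    exact ⟨hs, fun t hts ht => ⟨ht, hx.subset (Set.image_mono (by exact_mod_cast hts))⟩⟩
  singleton_mem v := ⟨by simp, v, by simpa using isCanonicalJoinRep_singleton v.2⟩

/-- The 1-skeleton of an abstract simplicial complex, as a graph: two distinct vertices are
adjacent when they span a face. -/
def AbstractSimplicialComplex.oneSkeleton {V : Type*} (K : AbstractSimplicialComplex V) :
    SimpleGraph V where
  Adj a b := a ≠ b ∧ ∃ s ∈ K, (s : Set V) = {a, b}
  symm := ⟨fun a b h => ⟨h.1.symm, by simpa [Set.pair_comm] using h.2⟩⟩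
  loopless := ⟨fun _ h => h.1 rfl⟩

/-- The canonical join graph: the 1-skeleton of the canonical join complex. -/
def canonicalJoinGraph (L : Type*) [Lattice L] [Finite L] : SimpleGraph {a : L // SupIrred a} :=
  (canonicalJoinComplex L).oneSkeleton

/-! Everything rests on the map `κ` from join-irreducibles to meet-irreducibles.
Meet-semidistributivity makes `κ(j)` exist (`exists_isKappa`), and join-semidistributivity makes `κ`
injective (`left_injective`). A pair `{j, k}` is a canonical join representation exactly when `j ≤
κ(k)` and `k ≤ κ(j)`. It remains to see that `κ(j_i) = m_i`. Write `κ(j_i) = m_{σ(i)}`. The chain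
gives `j_i ≤ m_k` for `i < k`, whereas `j_i ≰ κ(j_i)`, so `σ(i) ≤ i`; being injective, `σ` is the
identity. The criterion now says `j_i ≤ m_k` and `j_k ≤ m_i`: neither edge is present. -/

/-! ### The map `κ` of a semidistributive lattice -/

/-- `w` is the value at `j` of the map `κ`: the greatest element that lies above everything
strictly below `j`, but not above `j`. -/
def IsKappa {L : Type*} [Lattice L] (j w : L) : Prop :=
  IsGreatest {y : L | (∀ z < j, z ≤ y) ∧ ¬ j ≤ y} w

/-- All candidates `y` have the same meet with `j`, so by meet-semidistributivity the join of two
candidates is again one. A maximal candidate is therefore the greatest. -/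
theorem exists_isKappa {L : Type*} [Lattice L] [Finite L] (hsd : IsSemidistributive L) {j : L}
    (hj : SupIrred j) : ∃ w, IsKappa j w := by
  obtain ⟨z₀, hz₀⟩ : ∃ z, z < j := not_isMin_iff.1 hj.1
  obtain ⟨z, -, hz⟩ := (Set.toFinite {z : L | z < j}).exists_le_maximal hz₀
  -- Irreducibility of `j` makes the maximal `z < j` the greatest element strictly below `j`; hence
  -- `z` is itself a candidate.
  have hzT : (∀ z' < j, z' ≤ z) ∧ ¬ j ≤ z := by
    refine ⟨fun z' hz' => ?_, hz.prop.not_ge⟩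
    have hlt : z ⊔ z' < j := by
      refine lt_of_le_of_ne (sup_le hz.prop.le hz'.le) fun h => ?_
      rcases hj.2 h with h | h
      · exact hz.prop.ne h
      · exact hz'.ne h
    exact le_sup_right.trans (hz.le_of_ge hlt le_sup_left)
  obtain ⟨w, -, hw⟩ :=
    (Set.toFinite {y : L | (∀ z < j, z ≤ y) ∧ ¬ j ≤ y}).exists_le_maximal hzT
  have aux : ∀ y y' : L, ¬ j ≤ y → (∀ z < j, z ≤ y') → j ⊓ y ≤ j ⊓ y' := fun y y' h h' =>
    le_inf inf_le_left (h' _ (lt_of_le_of_ne inf_le_left fun e => h (inf_eq_left.1 e)))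
  refine ⟨w, hw.prop, fun y hy => ?_⟩
  have heq : j ⊓ w = j ⊓ y :=
    le_antisymm (aux w y hw.prop.2 hy.1) (aux y w hy.2 hw.prop.1)
  refine le_sup_right.trans (hw.le_of_ge (y := w ⊔ y)
    ⟨fun z hz => (hw.prop.1 z hz).trans le_sup_left, fun h => hw.prop.2 ?_⟩ le_sup_left)
  have := hsd.2 j w y heq
  rw [inf_eq_left.2 h] at this
  exact inf_eq_left.1 this.symm

namespace IsKappa

variable {L : Type*} [Lattice L] {j w : L}

theorem le_of_lt (h : IsKappa j w) {z : L} (hz : z < j) : z ≤ w := h.1.1 z hz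

theorem not_le (h : IsKappa j w) : ¬ j ≤ w := h.1.2

theorem le_of_gt (h : IsKappa j w) {y : L} (hy : w < y) : j ≤ y := by
  by_contra hjy
  exact hy.not_ge (h.2 ⟨fun z hz => (h.le_of_lt hz).trans hy.le, hjy⟩)

theorem infIrred (h : IsKappa j w) : InfIrred w := by
  refine ⟨fun hmax => h.not_le (le_sup_right.trans (hmax (le_sup_left : w ≤ w ⊔ j))),
    fun b d hbd => ?_⟩
  by_contra! hne
  apply h.not_le
  rw [← hbd]
  exact le_inf (h.le_of_gt (lt_of_le_of_ne (hbd ▸ inf_le_left) hne.1.symm))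
    (h.le_of_gt (lt_of_le_of_ne (hbd ▸ inf_le_right) hne.2.symm))

theorem le_sup (h : IsKappa j w) {b : L} (hb : ¬ b ≤ w) : j ≤ w ⊔ b :=
  h.le_of_gt (left_lt_sup.2 hb)

/-- If `j ≰ b`, then `j ⊓ b < j` lies below `w`, and join-semidistributivity collapses `w ⊔ j` to
`w`. -/
theorem le_of_sup_eq (hsd : IsSemidistributive L) (h : IsKappa j w) {b : L}
    (hb : w ⊔ j = w ⊔ b) : j ≤ b := by
  by_contra hjb
  have hle : j ⊓ b ≤ w :=
    h.le_of_lt (lt_of_le_of_ne inf_le_left fun e => hjb (inf_eq_left.1 e))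
  have := hsd.1 w j b hb
  rw [sup_eq_left.2 hle] at this
  exact h.not_le (sup_eq_left.1 this.symm)

/-- By `le_sup`, `w ⊔ j` and `w ⊔ j'` are both the least element strictly above `w`, hence equal. -/
theorem left_injective (hsd : IsSemidistributive L) {j' : L} (h : IsKappa j w)
    (h' : IsKappa j' w) : j = j' := by
  have heq : w ⊔ j = w ⊔ j' :=
    le_antisymm (sup_le le_sup_left (h.le_sup h'.not_le))
      (sup_le le_sup_left (h'.le_sup h.not_le))
  exact le_antisymm (h.le_of_sup_eq hsd heq) (h'.le_of_sup_eq hsd heq.symm)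

/-- If `k ≤ κ(j)`, then every join representation of `j ⊔ k` has an element above `j`. -/
theorem exists_le_of_isLUB (hsd : IsSemidistributive L) (h : IsKappa j w) {k : L} (hk : k ≤ w)
    {B : Set L} (hB : IsLUB B (j ⊔ k)) : ∃ b ∈ B, j ≤ b := by
  obtain ⟨b, hb, hbw⟩ : ∃ b ∈ B, ¬ b ≤ w := by
    by_contra! hall
    exact h.not_le (le_sup_left.trans (hB.2 hall))
  -- Here `w ⊔ j = w ⊔ b`, because `b ≤ j ⊔ k` and `k ≤ w`.
  refine ⟨b, hb, h.le_of_sup_eq hsd (le_antisymm (sup_le le_sup_left (h.le_sup hbw)) ?_)⟩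
  exact sup_le le_sup_left ((hB.1 hb).trans (sup_le le_sup_right (hk.trans le_sup_left)))

/-- If `{j, k}` is a canonical join representation, then `k ≤ κ(j)`. -/
theorem le_of_isCanonicalJoinRep [Finite L] (h : IsKappa j w) {k x : L} (hjk : j ≠ k)
    (hx : IsCanonicalJoinRep {j, k} x) : k ≤ w := by
  obtain ⟨hirr, hlub, hred, href⟩ := hx
  by_contra hkw
  -- When `k ≰ w`, the irreducibles strictly below `j` can replace `j`: an upper bound `u` of them
  -- and of `k` with `j ≰ u` would give `k ≤ u ≤ w`.
  have hBlub : IsLUB ({a : L | SupIrred a ∧ a < j} ∪ {k}) x := by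
    refine ⟨?_, fun u hu => hlub.2 ?_⟩
    · rintro b (hb | rfl)
      · exact hb.2.le.trans (hlub.1 (by simp))
      · exact hlub.1 (by simp)
    · have hku : k ≤ u := hu (Or.inr rfl)
      have hju : j ≤ u := by
        by_contra hju
        refine hkw (hku.trans (h.2 ⟨fun z hz => ?_, hju⟩))
        by_contra hzu
        obtain ⟨a, ha, haz, hau⟩ := exists_supIrred_le_not_le hzu
        exact hau (hu (Or.inl ⟨ha, haz.trans_lt hz⟩))
      rintro b (rfl | rfl)
      exacts [hju, hku]
  obtain ⟨b, hb | hb, hjb⟩ := href _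
    (by
      rintro b (hb | rfl)
      exacts [hb.1, hirr b (by simp)]) hBlub j (by simp)
  · exact hb.2.not_ge hjb
  -- Refinement has forced `j ≤ k`, so `{k}` alone already joins to `x`, against irredundancy.
  · rw [Set.mem_singleton_iff.1 hb] at hjb
    have hxk : x ≤ k := hlub.2 (by rintro c (rfl | rfl); exacts [hjb, le_rfl])
    refine (hred {k} ?_ k isLUB_singleton).not_ge hxk
    exact (Set.ssubset_iff_of_subset (by simp)).2 ⟨j, by simp, by simpa using hjk⟩

end IsKappa

/-- Two distinct join-irreducibles form a canonical join representation if and only if each lies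
below the image of the other under `κ`. -/
theorem exists_isCanonicalJoinRep_pair_iff {L : Type*} [Lattice L] [Finite L]
    (hsd : IsSemidistributive L) {j k w v : L} (hj : SupIrred j) (hk : SupIrred k) (hjk : j ≠ k)
    (hw : IsKappa j w) (hv : IsKappa k v) :
    (∃ x, IsCanonicalJoinRep {j, k} x) ↔ j ≤ v ∧ k ≤ w := by
  constructor
  · rintro ⟨x, hx⟩
    exact ⟨hv.le_of_isCanonicalJoinRep hjk.symm (Set.pair_comm j k ▸ hx),
      hw.le_of_isCanonicalJoinRep hjk hx⟩
  · rintro ⟨hjv, hkw⟩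
    refine ⟨j ⊔ k, ?_, isLUB_pair, fun A hA y hy => ?_, fun B _ hB a ha => ?_⟩
    · rintro a (rfl | rfl)
      exacts [hj, hk]
    · refine lt_of_le_of_ne (hy.mono isLUB_pair hA.1) ?_
      rintro rfl
      -- A subset missing `j` is bounded by `w`, and one missing `k` by `v`; neither bound is above
      -- `j ⊔ k`.
      obtain ⟨a, ha, haA⟩ := Set.exists_of_ssubset hA
      rcases ha with rfl | rfl
      · refine hw.not_le (le_sup_left.trans (hy.2 fun b hb => ?_))
        rcases hA.1 hb with rfl | rfl
        exacts [absurd hb haA, hkw]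
      · refine hv.not_le (le_sup_right.trans (hy.2 fun b hb => ?_))
        rcases hA.1 hb with rfl | rfl
        exacts [hjv, absurd hb haA]
    · rcases ha with rfl | rfl
      · exact hw.exists_le_of_isLUB hsd hkw hB
      · exact hv.exists_le_of_isLUB hsd hjv (sup_comm j _ ▸ hB)

/-! ### Comparing `κ` with the indexings induced by the chain. -/

/-- The chain element `c k.castSucc` separates the two: it is the join of the `j_l` with `l < k` and
the meet of the `m_l` with `l ≥ k`. -/
theorem joinIndexing_le_meetIndexing_of_lt {L : Type*} [Lattice L] [Finite L] (hL : IsExtremal L)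
    (c : LTSeries L) (hc : IsMaxLengthChain c) {i k : Fin c.length} (hik : i < k) :
    (joinIndexing hL c hc i : L) ≤ meetIndexing hL c hc k :=
  (((existsUnique_joinIndexing hL c hc).choose_spec.1 k.castSucc).1
      ⟨i, Fin.castSucc_lt_castSucc_iff.2 hik, rfl⟩).trans
    (((existsUnique_meetIndexing hL c hc).choose_spec.1 k.castSucc).1 ⟨k, le_rfl, rfl⟩)

/-- If `σ i < i`, then `σ i` is fixed by induction, so `σ` takes the same value at `i` and `σ i`. -/
theorem Function.Injective.eq_self_of_le {α : Type*} [PartialOrder α] [WellFoundedLT α]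
    {σ : α → α} (hσ : Function.Injective σ) (hle : ∀ i, σ i ≤ i) (i : α) : σ i = i := by
  induction i using WellFoundedLT.induction with
  | ind i ih =>
    by_contra hne
    exact hne (hσ (ih (σ i) (lt_of_le_of_ne (hle i) hne)))

/-- In an extremal semidistributive lattice, `κ` matches the indexings of the irreducibles. -/
theorem isKappa_joinIndexing_meetIndexing {L : Type*} [Lattice L] [Finite L] (hL : IsExtremal L)
    (hsd : IsSemidistributive L) (c : LTSeries L) (hc : IsMaxLengthChain c) (i : Fin c.length) :
    IsKappa (joinIndexing hL c hc i : L) (meetIndexing hL c hc i) := by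
  have hex : ∀ i, ∃ k, IsKappa (joinIndexing hL c hc i : L) (meetIndexing hL c hc k) := by
    intro i
    obtain ⟨w, hw⟩ := exists_isKappa hsd (joinIndexing hL c hc i).2
    obtain ⟨k, hk⟩ := (meetIndexing hL c hc).surjective ⟨w, hw.infIrred⟩
    exact ⟨k, by rwa [hk]⟩
  choose σ hσ using hex
  have hinj : Function.Injective σ := fun i k hik =>
    (joinIndexing hL c hc).injective
      (Subtype.ext ((hσ i).left_injective hsd (hik ▸ hσ k)))
  -- An index `σ i > i` would put `j_i` below `m_{σ i} = κ(j_i)`.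
  have hle : ∀ i, σ i ≤ i := fun i => not_lt.1 fun h =>
    (hσ i).not_le (joinIndexing_le_meetIndexing_of_lt hL c hc h)
  simpa only [hinj.eq_self_of_le hle i] using hσ i

theorem canonicalJoinGraph_adj {L : Type*} [Lattice L] [Finite L] {a b : {a : L // SupIrred a}} :
    (canonicalJoinGraph L).Adj a b ↔
      a ≠ b ∧ ∃ x : L, IsCanonicalJoinRep {(a : L), (b : L)} x := by
  refine and_congr_right fun _ => ⟨?_, ?_⟩
  · rintro ⟨s, ⟨-, x, hx⟩, hs⟩
    exact ⟨x, by simpa [hs, Set.image_pair] using hx⟩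
  · rintro ⟨x, hx⟩
    classical
    exact ⟨{a, b}, ⟨by simp, x, by simpa [Set.image_pair] using hx⟩, by simp⟩

/-- For a finite (nonempty) extremal semidistributive lattice `L` and any chain of maximal length,
the complement of the (undirected graph underlying the) Galois graph is the canonical join graph,
the vertex `i` of the Galois graph being identified with the join-irreducible `j_i`. -/
theorem corollary6p7 {L : Type*} [Lattice L] [Finite L] [Nonempty L]
    (hL : IsExtremal L) (hsd : IsSemidistributive L)
    (c : LTSeries L) (hc : IsMaxLengthChain c) :
    (galoisGraph hL c hc).toSimpleGraphInclusiveᶜ =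
      (canonicalJoinGraph L).comap (joinIndexing hL c hc) := by
  ext i k
  rw [SimpleGraph.compl_adj, SimpleGraph.comap_adj, canonicalJoinGraph_adj,
    (joinIndexing hL c hc).injective.ne_iff]
  refine and_congr_right fun hik => ?_
  rw [exists_isCanonicalJoinRep_pair_iff hsd (joinIndexing hL c hc i).2
    (joinIndexing hL c hc k).2
    (fun h => hik ((joinIndexing hL c hc).injective (Subtype.ext h)))
    (isKappa_joinIndexing_meetIndexing hL hsd c hc i)
    (isKappa_joinIndexing_meetIndexing hL hsd c hc k)]
  simp [Digraph.toSimpleGraphInclusive, galoisGraph, hik, hik.symm]
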